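/- Let $\Lambda$ and $\Gamma$ be left and right noetherian rings, and let $\operatorname{mod}\Lambda$ (resp. $\operatorname{mod}\Gamma^{op}$) be the category of finitely generated left $\Lambda$-modules (resp. right $\Gamma$-modules). Let ${}_\Lambda U_\Gamma$ be a bimodule with ${}_\Lambda U\in\operatorname{mod}\Lambda$ and $U_\Gamma\in\operatorname{mod}\Gamma^{op}$ which is faithfully balanced, i.e. the natural maps $\Lambda\to\operatorname{End}(U_\Gamma)$ and $\Gamma\to\operatorname{End}({}_\Lambda U)^{op}$ are isomorphisms, and selforthogonal, i.e. $\operatorname{Ext}^i_\Lambda({}_\Lambda U,{}_\Lambda U)=0$ and $\operatorname{Ext}^i_\Gamma(U_\Gamma,U_\Gamma)=0$ for all $i\ge 1$. For $M\in\operatorname{mod}\Lambda$ the group $\operatorname{Ext}^i_\Lambda(M,U)$ is regarded as a right $\Gamma$-module through the action of $\Gamma$ on $U$, and for $N\in\operatorname{mod}\Gamma^{op}$ the group $\operatorname{Ext}^i_\Gamma(N,U)$ is regarded as a left $\Lambda$-module through the action of $\Lambda$ on $U$. For $A$ in $\operatorname{mod}\Lambda$ (resp. in $\operatorname{mod}\Gamma^{op}$)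 and an integer $i\ge 0$, write $\operatorname{grade}_U A\ge i$ if $\operatorname{Ext}^j_\Lambda(A,U)=0$ (resp. $\operatorname{Ext}^j_\Gamma(A,U)=0$) for all $0\le j<i$. Then for every positive integer $k$ the following statements are equivalent. (1) $\operatorname{grade}_U\operatorname{Ext}^{i+1}_\Lambda(M,U)\ge i$ for all $M\in\operatorname{mod}\Lambda$ and $1\le i\le k-1$. (2) $\operatorname{Ext}^{i-1}_\Gamma(\operatorname{Ext}^{i+1}_\Lambda(M,U),U)=0$ for all $M\in\operatorname{mod}\Lambda$ and $1\le i\le k-1$. (1)$^{op}$ $\operatorname{grade}_U\operatorname{Ext}^{i+1}_\Gamma(N,U)\ge i$ for all $N\in\operatorname{mod}\Gamma^{op}$ and $1\le i\le k-1$. (2)$^{op}$ $\operatorname{Ext}^{i-1}_\Lambda(\operatorname{Ext}^{i+1}_\Gamma(N,U),U)=0$ for all $N\in\operatorname{mod}\Gamma^{op}$ and $1\le i\le k-1$. -/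

import Mathlib

open CategoryTheory CategoryTheory.Abelian

universe u

namespace BimoduleExt

/-! A bimodule `_Λ U _Γ` is encoded by commuting module structures over `R = Λ` and
`S = Γᵐᵒᵖ`; right `Γ`-modules are `Γᵐᵒᵖ`-modules. All definitions are symmetric in `R`, `S`. -/

section

variable (R S U : Type u) [Ring R] [Ring S] [AddCommGroup U] [Module R U] [Module S U]
  [SMulCommClass R S U] [SMulCommClass S R U]

/-- The action of `s : S` on `U`, as an `R`-linear endomorphism of `U`. -/
noncomputable def actHom (s : S) : ModuleCat.of R U ⟶ ModuleCat.of R U :=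
  ModuleCat.ofHom (Module.toModuleEnd R U s)

/-- The `S`-module structure on `Ext_R^n(M, U)` induced by functoriality in `U`:
`s` acts by postcomposition with the endomorphism `u ↦ s • u` of `U`. -/
noncomputable abbrev extModule (M : ModuleCat.{u} R) (n : ℕ) :
    Module S (Abelian.Ext M (ModuleCat.of R U) n) where
  smul s α := α.comp (Ext.mk₀ (actHom R S U s)) (add_zero n)
  one_smul α := by
    change α.comp (Ext.mk₀ (actHom R S U 1)) (add_zero n) = α
    have h : actHom R S U 1 = 𝟙 _ := by
      ext x; simp [actHom]
    rw [h, Ext.comp_mk₀_id]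
  mul_smul s t α := by
    change α.comp (Ext.mk₀ (actHom R S U (s * t))) (add_zero n) =
      (α.comp (Ext.mk₀ (actHom R S U t)) (add_zero n)).comp
        (Ext.mk₀ (actHom R S U s)) (add_zero n)
    have h : actHom R S U (s * t) = actHom R S U t ≫ actHom R S U s := by
      ext x; simp [actHom, mul_smul]
    rw [h, ← Ext.mk₀_comp_mk₀, Ext.comp_assoc_of_third_deg_zero]
  smul_zero s := by
    change (0 : Abelian.Ext M (ModuleCat.of R U) n).comp (Ext.mk₀ (actHom R S U s)) (add_zero n) = 0
    rw [Ext.zero_comp]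
  smul_add s α β := Ext.add_comp _ _ _ _
  add_smul s t α := by
    change α.comp (Ext.mk₀ (actHom R S U (s + t))) (add_zero n) =
      α.comp (Ext.mk₀ (actHom R S U s)) (add_zero n) +
        α.comp (Ext.mk₀ (actHom R S U t)) (add_zero n)
    have h : actHom R S U (s + t) = actHom R S U s + actHom R S U t := by
      ext x; simp [actHom, add_smul]
    rw [h, Ext.mk₀_add, Ext.comp_add]
  zero_smul α := by
    change α.comp (Ext.mk₀ (actHom R S U 0)) (add_zero n) = 0
    have h : actHom R S U 0 = 0 := by
      ext x; simp [actHom]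
    rw [h, Ext.mk₀_zero, Ext.comp_zero]

/-- `Ext_R^n(M, U)` as an `S`-module. -/
noncomputable def extMod (M : ModuleCat.{u} R) (n : ℕ) : ModuleCat.{u} S :=
  letI := extModule R S U M n
  ModuleCat.of S (Abelian.Ext M (ModuleCat.of R U) n)

/-- The bimodule `U` is faithfully balanced: the natural ring maps `R → End_S(U)` and
`S → End_R(U)` are isomorphisms. (For `S = Γᵐᵒᵖ`, the second one is the opposite of the natural
map `Γ → End(_Λ U)ᵒᵖ`.) -/
def FaithfullyBalanced : Prop :=
  Function.Bijective (Module.toModuleEnd S U : R →+* Module.End S U) ∧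
    Function.Bijective (Module.toModuleEnd R U : S →+* Module.End R U)

/-- The bimodule `U` is selforthogonal: it has no self-extensions in positive degrees, on either
side. -/
def SelfOrthogonal : Prop :=
  (∀ i : ℕ, 1 ≤ i → Subsingleton (Abelian.Ext (ModuleCat.of R U) (ModuleCat.of R U) i)) ∧
    ∀ i : ℕ, 1 ≤ i → Subsingleton (Abelian.Ext (ModuleCat.of S U) (ModuleCat.of S U) i)

end

/-- `grade_U A ≥ i`: `Ext_R^j(A, U) = 0` for all `0 ≤ j < i`. -/
def GradeGE (R U : Type u) [Ring R] [AddCommGroup U] [Module R U] (A : ModuleCat.{u} R)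
    (i : ℕ) : Prop :=
  ∀ j : ℕ, j < i → Subsingleton (Abelian.Ext A (ModuleCat.of R U) j)

end BimoduleExt

/-! Write * for the dual with respect to `U`, on either side. Shifting along syzygies makes (1) and
(2) equivalent to the single condition `ExtExtVanish`, so what matters is exchanging the sides,
`ExtExtVanish.swap`, by induction. The step from k+1 to k+2 leaves one new vanishing:
Ext_R^k(Ext_S^{k+2}(N, U), U) = 0.

Resolve N by free modules F_n with syzygies K_n. Let J_n be the image of F_n* → K_{n+1}*, and X_n =
F_{n+1}*/J_n. Then Ext_S^{n+1}(N, U) = K_{n+1}*/J_n lies in X_n with quotient J_{n+1}. The induction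
hypothesis kills enough of Ext_R(X_n, U) (`subsingleton_ext_X`) to reduce the claim to E = 0, where
E = Ext_R^{k+1}(J_{k+2}, U).

Since E ≅ Ext_R^{k+2}(X_{k+2}, U), the assumed condition gives E grade at least k+1. By balance and
selforthogonality this passes from `U` to free modules and then to syzygies, so Ext_S^{k+1}(E,
K_{k+2}) → Ext_S^{k+1}(E, F_{k+1}) is injective. `hom_extMod_eq_zero` turns this injectivity into
the vanishing of the identity of E. -/

set_option linter.unusedSectionVars false

/-! ### Vanishing and naturality in long exact Ext sequences -/

namespace CategoryTheory.Abelian.Ext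

universe w v u'

variable {C : Type u'} [Category.{v} C] [Abelian C] [HasExt.{w} C] {T : ShortComplex C}

lemma subsingleton_covariant₁ (hT : T.ShortExact) (X : C) {n m : ℕ} (h : n + 1 = m)
    (h₃ : Subsingleton (Ext X T.X₃ n)) (h₂ : Subsingleton (Ext X T.X₂ m)) :
    Subsingleton (Ext X T.X₁ m) := by
  refine subsingleton_of_forall_eq 0 fun x ↦ ?_
  obtain ⟨y, rfl⟩ := covariant_sequence_exact₁ X hT x (Subsingleton.elim _ _) h
  rw [Subsingleton.elim y 0, zero_comp]

lemma subsingleton_covariant₁_zero (hT : T.ShortExact) (X : C)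
    (h₂ : Subsingleton (Ext X T.X₂ 0)) : Subsingleton (Ext X T.X₁ 0) := by
  have := hT.mono_f
  exact (postcomp_mk₀_injective_of_mono X T.f).subsingleton

lemma subsingleton_covariant₂ (hT : T.ShortExact) (X : C) {n : ℕ}
    (h₁ : Subsingleton (Ext X T.X₁ n)) (h₃ : Subsingleton (Ext X T.X₃ n)) :
    Subsingleton (Ext X T.X₂ n) := by
  refine subsingleton_of_forall_eq 0 fun x ↦ ?_
  obtain ⟨y, rfl⟩ := covariant_sequence_exact₂ X hT x (Subsingleton.elim _ _)
  rw [Subsingleton.elim y 0, zero_comp]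

lemma subsingleton_contravariant₁ (hT : T.ShortExact) (Y : C) {n m : ℕ} (h : 1 + n = m)
    (h₂ : Subsingleton (Ext T.X₂ Y n)) (h₃ : Subsingleton (Ext T.X₃ Y m)) :
    Subsingleton (Ext T.X₁ Y n) := by
  refine subsingleton_of_forall_eq 0 fun x ↦ ?_
  obtain ⟨y, rfl⟩ := contravariant_sequence_exact₁ hT Y x h (Subsingleton.elim _ _)
  rw [Subsingleton.elim y 0, comp_zero]

lemma subsingleton_contravariant₂ (hT : T.ShortExact) (Y : C) {n : ℕ}
    (h₁ : Subsingleton (Ext T.X₁ Y n)) (h₃ : Subsingleton (Ext T.X₃ Y n)) :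
    Subsingleton (Ext T.X₂ Y n) := by
  refine subsingleton_of_forall_eq 0 fun x ↦ ?_
  obtain ⟨y, rfl⟩ := contravariant_sequence_exact₂ hT Y x (Subsingleton.elim _ _)
  rw [Subsingleton.elim y 0, comp_zero]

lemma subsingleton_contravariant₃ (hT : T.ShortExact) (Y : C) {n m : ℕ} (h : 1 + n = m)
    (h₁ : Subsingleton (Ext T.X₁ Y n)) (h₂ : Subsingleton (Ext T.X₂ Y m)) :
    Subsingleton (Ext T.X₃ Y m) := by
  refine subsingleton_of_forall_eq 0 fun x ↦ ?_
  obtain ⟨y, rfl⟩ := contravariant_sequence_exact₃ hT Y x (Subsingleton.elim _ _) h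
  rw [Subsingleton.elim y 0, comp_zero]

lemma subsingleton_of_iso_left {X X' : C} (e : X ≅ X') (Y : C) {n : ℕ}
    (h : Subsingleton (Ext X Y n)) : Subsingleton (Ext X' Y n) := by
  refine subsingleton_of_forall_eq 0 fun x ↦ ?_
  have : x = (mk₀ e.inv).comp ((mk₀ e.hom).comp x (zero_add n)) (zero_add n) := by simp
  rw [this, Subsingleton.elim ((mk₀ e.hom).comp x (zero_add n)) 0, comp_zero]

lemma subsingleton_of_iso_right (X : C) {Y Y' : C} (e : Y ≅ Y') {n : ℕ}
    (h : Subsingleton (Ext X Y n)) : Subsingleton (Ext X Y' n) := by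
  refine subsingleton_of_forall_eq 0 fun x ↦ ?_
  have : x = (x.comp (mk₀ e.inv) (add_zero n)).comp (mk₀ e.hom) (add_zero n) := by
    rw [comp_assoc_of_third_deg_zero, mk₀_comp_mk₀, e.inv_hom_id, comp_mk₀_id]
  rw [this, Subsingleton.elim (x.comp (mk₀ e.inv) (add_zero n)) 0, zero_comp]

lemma comp_extClass_comp_mk₀_f_comp (hT : T.ShortExact) {X Y : C} {n m : ℕ} (h : n + 1 = m)
    (x : Ext X T.X₃ n) (k : T.X₁ ⟶ Y) (l : T.X₂ ⟶ Y) (hk : T.f ≫ l = k) :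
    (x.comp hT.extClass h).comp (mk₀ k) (add_zero m) = 0 := by
  rw [← hk, ← mk₀_comp_mk₀, comp_assoc x _ _ h (add_zero 1) (by lia),
    hT.extClass_comp_assoc, comp_zero]

lemma comp_extClass_comp_mk₀_τ₁ {T' : ShortComplex C} (hT : T.ShortExact) (hT' : T'.ShortExact)
    (φ : T ⟶ T') {X : C} {n m : ℕ} (h : n + 1 = m) (x : Ext X T.X₃ n) :
    (x.comp hT.extClass h).comp (mk₀ φ.τ₁) (add_zero m) =
      (x.comp (mk₀ φ.τ₃) (add_zero n)).comp hT'.extClass h := by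
  rw [comp_assoc x _ _ h (add_zero 1) (by lia),
    ShortComplex.ShortExact.extClass_naturality hT hT' φ,
    comp_assoc x _ _ (add_zero n) (zero_add 1) (by lia)]

end CategoryTheory.Abelian.Ext

/-! ### Ext of finite powers and free modules -/

namespace BimoduleExt

open Ext

section

variable {R : Type u} [Ring R] {A B C : Type u} [AddCommGroup A] [AddCommGroup B] [AddCommGroup C]
  [Module R A] [Module R B] [Module R C]

lemma shortExact_ofHom {f : A →ₗ[R] B} {g : B →ₗ[R] C} (hf : Function.Injective f)
    (hfg : Function.Exact f g) (hg : Function.Surjective g) :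
    (ModuleCat.shortComplexOfCompEqZero f g hfg.linearMap_comp_eq_zero).ShortExact :=
  ModuleCat.shortComplex_shortExact _ hfg hf hg

/-- The inclusion of the first factor in `Fin (n + 1) → A` and the projection to the other factors
form a short exact sequence. -/
lemma shortExact_fin_succ (n : ℕ) :
    Function.Injective (LinearMap.single R (fun _ : Fin (n + 1) ↦ A) 0) ∧
    Function.Exact (LinearMap.single R (fun _ : Fin (n + 1) ↦ A) 0)
      (LinearMap.funLeft R A (Fin.succ : Fin n → Fin (n + 1))) ∧
    Function.Surjective (LinearMap.funLeft R A (Fin.succ : Fin n → Fin (n + 1))) := by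
  refine ⟨Pi.single_injective (M := fun _ : Fin (n + 1) ↦ A) 0, fun x ↦ ⟨fun h ↦ ⟨x 0, ?_⟩, ?_⟩, fun x ↦
    ⟨Fin.cons 0 x, by ext i; simp [LinearMap.funLeft]⟩⟩
  · ext i
    refine Fin.cases (by simp) (fun i ↦ ?_) i
    simpa using (congr_fun h i).symm
  · rintro ⟨a, rfl⟩
    ext i
    simp [LinearMap.funLeft]

lemma subsingleton_ext_pi_left (Y : ModuleCat.{u} R) {j : ℕ}
    (h : Subsingleton (Ext (ModuleCat.of R A) Y j)) (n : ℕ) :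
    Subsingleton (Ext (ModuleCat.of R (Fin n → A)) Y j) := by
  induction n with
  | zero =>
    refine subsingleton_of_forall_eq 0 fun x ↦ ?_
    rw [← mk₀_id_comp x, (ModuleCat.isZero_of_subsingleton (ModuleCat.of R (Fin 0 → A))).eq_of_src
      (𝟙 _) 0, mk₀_zero, zero_comp]
  | succ n ih =>
    obtain ⟨h₁, h₂, h₃⟩ := shortExact_fin_succ (R := R) (A := A) n
    exact subsingleton_contravariant₂ (shortExact_ofHom h₁ h₂ h₃) Y h ih

lemma subsingleton_ext_pi_right (X : ModuleCat.{u} R) {j : ℕ}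
    (h : Subsingleton (Ext X (ModuleCat.of R A) j)) (n : ℕ) :
    Subsingleton (Ext X (ModuleCat.of R (Fin n → A)) j) := by
  induction n with
  | zero =>
    refine subsingleton_of_forall_eq 0 fun x ↦ ?_
    rw [← comp_mk₀_id x, (ModuleCat.isZero_of_subsingleton (ModuleCat.of R (Fin 0 → A))).eq_of_src
      (𝟙 _) 0, mk₀_zero, comp_zero]
  | succ n ih =>
    obtain ⟨h₁, h₂, h₃⟩ := shortExact_fin_succ (R := R) (A := A) n
    exact subsingleton_covariant₂ (shortExact_ofHom h₁ h₂ h₃) X h ih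

lemma subsingleton_ext_free (Y : ModuleCat.{u} R) (n : ℕ) {j : ℕ} (hj : 1 ≤ j) :
    Subsingleton (Ext (ModuleCat.of R (Fin n → R)) Y j) := by
  obtain ⟨j, rfl⟩ := Nat.exists_eq_add_of_le' hj
  have : Projective (ModuleCat.of R (Fin n → R)) :=
    ModuleCat.projective_of_categoryTheory_projective _
  exact subsingleton_of_projective _ _ _

end

end BimoduleExt

/-! ### Module structure on Ext, duals and acyclic modules -/

namespace BimoduleExt

open Ext

section

variable {R S U : Type u} [Ring R] [Ring S] [AddCommGroup U] [Module R U] [Module S U]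
  [SMulCommClass R S U] [SMulCommClass S R U]

variable (S U) in
/-- Precomposition with an extension class, as an `S`-linear map between the modules
`Ext_R(-, U)`. -/
noncomputable def extModPrecomp {M M' : ModuleCat.{u} R} {a n n' : ℕ} (ξ : Ext M M' a)
    (h : a + n = n') : extMod R S U M' n ⟶ extMod R S U M n' :=
  letI := extModule R S U M' n
  letI := extModule R S U M n'
  ModuleCat.ofHom
    { toFun := fun x ↦ ξ.comp x h
      map_add' := fun _ _ ↦ comp_add _ _ _ _
      map_smul' := fun s x ↦ (comp_assoc_of_third_deg_zero ξ x (mk₀ (actHom R S U s)) h).symm }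

lemma bijective_extClass_comp {T : ShortComplex (ModuleCat.{u} R)} (hT : T.ShortExact)
    {n m : ℕ} (hnm : 1 + n = m) (h : Subsingleton (Ext T.X₂ (ModuleCat.of R U) n))
    (h' : Subsingleton (Ext T.X₂ (ModuleCat.of R U) m)) :
    Function.Bijective (fun x : Ext T.X₁ (ModuleCat.of R U) n ↦ hT.extClass.comp x hnm) := by
  refine ⟨fun x y hxy ↦ ?_, fun x ↦
    contravariant_sequence_exact₃ hT _ x (Subsingleton.elim _ _) hnm⟩
  obtain ⟨z, hz⟩ := contravariant_sequence_exact₁ hT _ (x - y) hnm (by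
    rw [sub_eq_add_neg, comp_add, comp_neg, ← sub_eq_add_neg, sub_eq_zero]; exact hxy)
  rw [Subsingleton.elim z 0, comp_zero] at hz
  exact sub_eq_zero.mp hz.symm

variable (S) in
/-- Dimension shifting for the `S`-modules `Ext_R(-, U)`. -/
lemma nonempty_extMod_iso {T : ShortComplex (ModuleCat.{u} R)} (hT : T.ShortExact)
    {n m : ℕ} (hnm : 1 + n = m) (h : Subsingleton (Ext T.X₂ (ModuleCat.of R U) n))
    (h' : Subsingleton (Ext T.X₂ (ModuleCat.of R U) m)) :
    Nonempty (extMod R S U T.X₁ n ≅ extMod R S U T.X₃ m) :=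
  ⟨(LinearEquiv.ofBijective (extModPrecomp S U hT.extClass hnm).hom
    (bijective_extClass_comp hT hnm h h')).toModuleIso⟩

variable {A B C : Type u} [AddCommGroup A] [AddCommGroup B] [AddCommGroup C]
  [Module R A] [Module R B] [Module R C]

variable (S U) in
/-- The connecting homomorphism `Hom_R(A, U) → Ext_R^1(C, U)` is `S`-linear, and exact. -/
lemma exists_connecting {f : A →ₗ[R] B} {g : B →ₗ[R] C} (hf : Function.Injective f)
    (hfg : Function.Exact f g) (hg : Function.Surjective g) :
    ∃ δ : (A →ₗ[R] U) →ₗ[S] extMod R S U (ModuleCat.of R C) 1,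
      Function.Exact (LinearMap.lcomp S U f) δ ∧
      (Subsingleton (Ext (ModuleCat.of R B) (ModuleCat.of R U) 1) → Function.Surjective δ) := by
  let := extModule R S U (ModuleCat.of R C) 1
  have hT := shortExact_ofHom hf hfg hg
  let δ : (A →ₗ[R] U) →ₗ[S] Ext (ModuleCat.of R C) (ModuleCat.of R U) 1 :=
    { toFun := fun x ↦ hT.extClass.comp (mk₀ (ModuleCat.ofHom x)) (add_zero 1)
      map_add' := fun x y ↦ by rw [ModuleCat.ofHom_add, mk₀_add, comp_add]
      map_smul' := fun s x ↦ by
        have : ModuleCat.ofHom (s • x) = ModuleCat.ofHom x ≫ actHom R S U s := by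
          ext; simp [actHom]
        rw [this, ← mk₀_comp_mk₀, ← comp_assoc_of_third_deg_zero]
        rfl }
  refine ⟨δ, fun x ↦ ⟨fun hx ↦ ?_, ?_⟩, fun h x ↦ ?_⟩
  · obtain ⟨y, hy⟩ := contravariant_sequence_exact₁ hT _ (mk₀ (ModuleCat.ofHom x)) (add_zero 1) hx
    obtain ⟨y, rfl⟩ := (mk₀_bijective _ _).2 y
    rw [mk₀_comp_mk₀] at hy
    exact ⟨y.hom, congr_arg ModuleCat.Hom.hom ((mk₀_bijective _ _).1 hy)⟩
  · rintro ⟨y, rfl⟩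
    have : ModuleCat.ofHom (LinearMap.lcomp S U f y) = ModuleCat.ofHom f ≫ ModuleCat.ofHom y := rfl
    change hT.extClass.comp (mk₀ (ModuleCat.ofHom (LinearMap.lcomp S U f y))) (add_zero 1) = 0
    rw [this, ← mk₀_comp_mk₀]
    exact hT.extClass_comp_assoc _
  · obtain ⟨y, hy⟩ := contravariant_sequence_exact₃ hT _ x (Subsingleton.elim _ _) (add_zero 1)
    obtain ⟨y, rfl⟩ := (mk₀_bijective _ _).2 y
    exact ⟨y.hom, hy⟩

variable (S) in
lemma surjective_lcomp {f : A →ₗ[R] B} {g : B →ₗ[R] C} (hf : Function.Injective f)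
    (hfg : Function.Exact f g) (hg : Function.Surjective g)
    (h : Subsingleton (Ext (ModuleCat.of R C) (ModuleCat.of R U) 1)) :
    Function.Surjective (LinearMap.lcomp S U f) := by
  obtain ⟨δ, hδ, -⟩ := exists_connecting S U hf hfg hg
  have : Subsingleton (extMod R S U (ModuleCat.of R C) 1) := h
  exact fun x ↦ (hδ x).1 (Subsingleton.elim _ _)

variable (S U) in
lemma injective_lcomp {g : B →ₗ[R] C} (hg : Function.Surjective g) :
    Function.Injective (LinearMap.lcomp S U g) := fun x y h ↦
  LinearMap.ext fun c ↦ by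
    obtain ⟨b, rfl⟩ := hg c
    exact LinearMap.congr_fun h b

variable (S U) in
lemma exact_lcomp {f : A →ₗ[R] B} {g : B →ₗ[R] C}
    (hfg : Function.Exact f g) (hg : Function.Surjective g) :
    Function.Exact (LinearMap.lcomp S U g) (LinearMap.lcomp S U f) :=
  fun x ↦ by
  refine ⟨fun hx ↦ ?_, ?_⟩
  · have hle : LinearMap.ker g ≤ LinearMap.ker x := fun b hb ↦ by
      obtain ⟨a, rfl⟩ := (hfg b).1 hb
      exact LinearMap.congr_fun hx a
    refine ⟨(LinearMap.ker g).liftQ x hle ∘ₗ (g.quotKerEquivOfSurjective hg).symm.toLinearMap, ?_⟩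
    ext b
    have : (g.quotKerEquivOfSurjective hg).symm (g b) = Submodule.Quotient.mk b :=
      (LinearEquiv.symm_apply_eq _).2 rfl
    simp [this]
  · rintro ⟨y, rfl⟩
    ext a
    simp [hfg.apply_apply_eq_zero a]

variable (R S U) in
/-- The dual of a finite free module is a finite power of `U`. -/
noncomputable def dualFreeEquiv (n : ℕ) : (Fin n → U) ≃ₗ[S] ((Fin n → R) →ₗ[R] U) :=
  (Pi.basisFun R (Fin n)).constr S

variable (R) in
lemma finite_dual [IsNoetherianRing S] [Module.Finite S U] [Module.Finite R A] :
    Module.Finite S (A →ₗ[R] U) := by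
  obtain ⟨n, p, hp⟩ := Module.Finite.exists_fin' R A
  have : IsNoetherian S ((Fin n → R) →ₗ[R] U) := isNoetherian_of_linearEquiv (dualFreeEquiv R S U n)
  exact Module.Finite.of_injective _ (injective_lcomp S U hp)

variable (R U) in
/-- A module without extensions by `U` in positive degrees. -/
def Acyclic (V : Type u) [AddCommGroup V] [Module R V] : Prop :=
  ∀ j : ℕ, 1 ≤ j → Subsingleton (Ext (ModuleCat.of R V) (ModuleCat.of R U) j)

variable (R U) in
lemma Acyclic.free (n : ℕ) : Acyclic R U (Fin n → R) := fun _ hj ↦ subsingleton_ext_free _ n hj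

lemma Acyclic.ker {f : A →ₗ[R] B} {g : B →ₗ[R] C} (hf : Function.Injective f)
    (hfg : Function.Exact f g) (hg : Function.Surjective g) (hB : Acyclic R U B)
    (hC : Acyclic R U C) : Acyclic R U A := fun j hj ↦
  subsingleton_contravariant₁ (shortExact_ofHom hf hfg hg) _ rfl (hB j hj) (hC _ (by lia))

lemma Acyclic.dual_free (h : ∀ i : ℕ, 1 ≤ i →
      Subsingleton (Ext (ModuleCat.of S U) (ModuleCat.of S U) i)) (n : ℕ) :
    Acyclic S U ((Fin n → R) →ₗ[R] U) := fun j hj ↦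
  subsingleton_of_iso_left (dualFreeEquiv R S U n).toModuleIso _
    (subsingleton_ext_pi_left _ (h j hj) n)

lemma subsingleton_ext_dual_free (E : ModuleCat.{u} S) {j : ℕ}
    (h : Subsingleton (Ext E (ModuleCat.of S U) j)) (n : ℕ) :
    Subsingleton (Ext E (ModuleCat.of S ((Fin n → R) →ₗ[R] U)) j) :=
  subsingleton_of_iso_right _ (dualFreeEquiv R S U n).toModuleIso
    (subsingleton_ext_pi_right _ h n)

/-- Dualizing a finite free cover embeds A* in a finite power of `U`. -/
lemma subsingleton_ext_zero_dual (E : ModuleCat.{u} S)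
    (h : Subsingleton (Ext E (ModuleCat.of S U) 0)) [Module.Finite R A] :
    Subsingleton (Ext E (ModuleCat.of S (A →ₗ[R] U)) 0) := by
  obtain ⟨n, p, hp⟩ := Module.Finite.exists_fin' R A
  have := subsingleton_ext_dual_free (R := R) E h n
  have : Mono (ModuleCat.ofHom (LinearMap.lcomp S U p)) :=
    (ModuleCat.mono_iff_injective _).2 (injective_lcomp S U hp)
  exact (postcomp_mk₀_injective_of_mono E (ModuleCat.ofHom (LinearMap.lcomp S U p))).subsingleton

/-- The dual of a finite free cover of `A` is again short exact because Ext_R^1(A, U) = 0, and its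
kernel is again finite and acyclic. This lowers the degree one step at a time until Hom is reached.
-/
lemma Acyclic.subsingleton_ext_dual [IsNoetherianRing R] (E : ModuleCat.{u} S) {m : ℕ}
    (hE : GradeGE S U E m) {j : ℕ} (hj : j < m) [Module.Finite R A] (hA : Acyclic R U A) :
    Subsingleton (Ext E (ModuleCat.of S (A →ₗ[R] U)) j) := by
  induction j generalizing A with
  | zero => exact subsingleton_ext_zero_dual E (hE 0 hj)
  | succ j ih =>
    obtain ⟨n, p, hp⟩ := Module.Finite.exists_fin' R A
    have hi := (LinearMap.ker p).injective_subtype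
    have hK : Acyclic R U (LinearMap.ker p) :=
      .ker hi (LinearMap.exact_subtype_ker_map p) hp (.free R U n) hA
    exact subsingleton_covariant₁ (shortExact_ofHom (injective_lcomp S U hp)
      (exact_lcomp S U (LinearMap.exact_subtype_ker_map p) hp)
      (surjective_lcomp S hi (LinearMap.exact_subtype_ker_map p) hp (hA 1 le_rfl))) E rfl
      (ih (by lia) hK) (subsingleton_ext_dual_free E (hE _ hj) n)

end

end BimoduleExt

/-! ### Homomorphisms into Ext modules; biduals -/

namespace BimoduleExt

open Ext

section

variable {R S U : Type u} [Ring R] [Ring S] [AddCommGroup U] [Module R U] [Module S U]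
  [SMulCommClass R S U] [SMulCommClass S R U]

/-- Let `0 → W → P → I → 0` be exact with `P` acyclic, and let `V → W` be a map from an acyclic
module. If `Ext_S^{m+1}(E, -)` is injective on the composite of the image `L` of `P* → W*` with
`W* → V*`, then there are no nonzero maps from `E` to `Ext_R^{m+1}(I, U)`, provided that `E` has
grade at least `m + 1` and the lower extensions of `I` vanish. -/
lemma hom_extMod_eq_zero [IsNoetherianRing R] (E : ModuleCat.{u} S) (m : ℕ)
    (hE : GradeGE S U E (m + 1)) :
    ∀ {W P I V L : Type u} [AddCommGroup W] [AddCommGroup P] [AddCommGroup I] [AddCommGroup V]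
      [AddCommGroup L] [Module R W] [Module R P] [Module R I] [Module R V] [Module S L]
      [Module.Finite R W] [Module.Finite R V] {i : W →ₗ[R] P} {q : P →ₗ[R] I},
      Function.Injective i → Function.Exact i q → Function.Surjective q →
      Acyclic R U P → Acyclic R U V → ∀ (g : V →ₗ[R] W) (l : L →ₗ[S] (W →ₗ[R] U)),
      Function.Injective l → LinearMap.range l = LinearMap.range (LinearMap.lcomp S U i) →
      (∀ j, 1 ≤ j → j < m + 1 → Subsingleton (Ext (ModuleCat.of R I) (ModuleCat.of R U) j)) →
      (∀ x : Ext E (ModuleCat.of S L) (m + 1),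
        x.comp (mk₀ (ModuleCat.ofHom (LinearMap.lcomp S U g ∘ₗ l))) (add_zero _) = 0 → x = 0) →
      ∀ f : E ⟶ extMod R S U (ModuleCat.of R I) (m + 1), f = 0 := by
  induction m with
  | zero =>
    intro W P I V L _ _ _ _ _ _ _ _ _ _ _ _ i q hi hiq hq hP hV g l hl hr hI hx f
    obtain ⟨δ, hδ, hδ'⟩ := exists_connecting S U hi hiq hq
    -- Thus 0 → L → W* → Ext_R^1(I, U) → 0 is exact.
    have hlδ : Function.Exact l δ := fun y ↦ by
      rw [hδ y]
      exact (SetLike.ext_iff.1 hr y).symm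
    have hT := shortExact_ofHom hl hlδ (hδ' (hP 1 le_rfl))
    -- The pullback of this extension along `f` dies in Ext_S^1(E, W*), hence in Ext_S^1(E, V*), so
    -- it is zero. Then `f` lifts to W*, which receives no nonzero map from `E`.
    have hfT : (mk₀ f).comp hT.extClass (zero_add 1) = 0 :=
      hx _ (comp_extClass_comp_mk₀_f_comp hT _ _ _ (ModuleCat.ofHom (LinearMap.lcomp S U g)) rfl)
    obtain ⟨y, hy⟩ := covariant_sequence_exact₃ E hT (mk₀ f) (zero_add 1) hfT
    have := subsingleton_ext_zero_dual (R := R) (A := W) E (hE 0 (by lia))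
    rw [Subsingleton.elim y 0, zero_comp] at hy
    exact (mk₀_eq_zero_iff f).1 hy.symm
  | succ m ih =>
    intro W P I V L _ _ _ _ _ _ _ _ _ _ _ _ i q hi hiq hq hP hV g l hl hr hI hx f
    -- As Ext_R^1(I, U) = 0, `L` is all of W*; `hx'` restates the injectivity hypothesis there.
    have hl' : Function.Surjective l := LinearMap.range_eq_top.1 (by
      rw [hr, LinearMap.range_eq_top.2 (surjective_lcomp S hi hiq hq (hI 1 le_rfl (by lia)))])
    let e := LinearEquiv.ofBijective l ⟨hl, hl'⟩
    have hx' (y : Ext E (ModuleCat.of S (W →ₗ[R] U)) (m + 2))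
        (hy : y.comp (mk₀ (ModuleCat.ofHom (LinearMap.lcomp S U g))) (add_zero _) = 0) :
        y = 0 := by
      have h₁ : ModuleCat.ofHom e.symm.toLinearMap ≫
          ModuleCat.ofHom (LinearMap.lcomp S U g ∘ₗ l) =
          ModuleCat.ofHom (LinearMap.lcomp S U g) := by
        rw [← ModuleCat.ofHom_comp]
        congr 1
        ext1 z
        exact congr_arg (LinearMap.lcomp S U g) (e.apply_symm_apply z)
      have h₂ : ModuleCat.ofHom e.symm.toLinearMap ≫ ModuleCat.ofHom l =
          𝟙 (ModuleCat.of S (W →ₗ[R] U)) := by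
        rw [← ModuleCat.ofHom_comp, ← ModuleCat.ofHom_id]
        congr 1
        ext1 z
        exact e.apply_symm_apply z
      have h₃ := hx (y.comp (mk₀ (ModuleCat.ofHom e.symm.toLinearMap)) (add_zero _)) (by
        rw [comp_assoc_of_third_deg_zero, mk₀_comp_mk₀, h₁, hy])
      rw [← comp_mk₀_id y, ← h₂, ← mk₀_comp_mk₀, ← comp_assoc_of_third_deg_zero, h₃, zero_comp]
    -- The induction runs on 0 → ker p → R^a → W → 0, with ker p' in place of `V`: Ext_R^{m+1}(W, U)
    -- ≅ Ext_R^{m+2}(I, U).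
    obtain ⟨a, p, hp⟩ := Module.Finite.exists_fin' R W
    obtain ⟨b, p', hp'⟩ := Module.Finite.exists_fin' R V
    obtain ⟨t, ht⟩ := Module.projective_lifting_property p (g ∘ₗ p') hp
    let g' : LinearMap.ker p' →ₗ[R] LinearMap.ker p := t.restrict fun x hx ↦ by
      have := LinearMap.congr_fun ht x
      simp only [LinearMap.comp_apply] at this
      rw [LinearMap.mem_ker, this, LinearMap.mem_ker.1 hx, map_zero]
    have hi₁ := (LinearMap.ker p).injective_subtype
    have hi₂ := (LinearMap.ker p').injective_subtype
    have hp₁ := LinearMap.exact_subtype_ker_map p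
    have hp₂ := LinearMap.exact_subtype_ker_map p'
    let r := LinearMap.lcomp S U (LinearMap.ker p).subtype
    have hrp : Function.Exact (LinearMap.lcomp S U p) r.rangeRestrict := fun x ↦
      Iff.trans (by rw [← Subtype.coe_inj]; rfl) (exact_lcomp S U hp₁ hp x)
    have hT₁ := shortExact_ofHom (injective_lcomp S U hp) hrp r.surjective_rangeRestrict
    have hT₂ := shortExact_ofHom (injective_lcomp S U hp') (exact_lcomp S U hp₂ hp')
      (surjective_lcomp S hi₂ hp₂ hp' (hV 1 le_rfl))
    have key := ih (fun j hj ↦ hE j (by lia)) hi₁ hp₁ hp (.free R U a)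
      (.ker hi₂ hp₂ hp' (.free R U b) hV) g' (LinearMap.range r).subtype
      (Submodule.injective_subtype _) (Submodule.range_subtype _)
      (fun j hj hj' ↦ subsingleton_contravariant₁ (shortExact_ofHom hi hiq hq) _ rfl (hP j hj)
        (hI _ (by lia) (by lia))) (fun x h ↦ by
        let φ : ModuleCat.shortComplexOfCompEqZero _ _ hrp.linearMap_comp_eq_zero ⟶
            ModuleCat.shortComplexOfCompEqZero _ _
              (exact_lcomp S U hp₂ hp').linearMap_comp_eq_zero :=
          { τ₁ := ModuleCat.ofHom (LinearMap.lcomp S U g)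
            τ₂ := ModuleCat.ofHom (LinearMap.lcomp S U t)
            τ₃ := ModuleCat.ofHom (LinearMap.lcomp S U g' ∘ₗ (LinearMap.range r).subtype)
            comm₁₂ := by
              ext y : 2
              exact LinearMap.ext fun z ↦ congr_arg y (LinearMap.congr_fun ht z).symm
            comm₂₃ := rfl }
        -- By naturality of the connecting map, the image of `x` in Ext_S^{m+2}(E, W*) dies in
        -- Ext_S^{m+2}(E, V*), so `hx'` applies.
        have h₁ : x.comp hT₁.extClass rfl = 0 :=
          hx' _ ((comp_extClass_comp_mk₀_τ₁ hT₁ hT₂ φ rfl x).trans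
            ((congr_arg (fun z ↦ z.comp hT₂.extClass rfl) h).trans (zero_comp ..)))
        obtain ⟨y, rfl⟩ := covariant_sequence_exact₃ E hT₁ x rfl h₁
        have := subsingleton_ext_dual_free (R := R) E (hE (m + 1) (by lia)) a
        rw [Subsingleton.elim y 0, zero_comp])
    obtain ⟨ε⟩ := nonempty_extMod_iso S (shortExact_ofHom hi hiq hq) (U := U) (n := m + 1)
      (m := m + 1 + 1) (by lia) (hP _ (by lia)) (hP _ (by lia))
    rw [← cancel_mono ε.inv, key (f ≫ ε.inv)]
    simp

variable (R S U) in
/-- The evaluation map from a module to its bidual with respect to `U`. -/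
def evalBidual (M : Type u) [AddCommGroup M] [Module S M] :
    M →ₗ[S] ((M →ₗ[S] U) →ₗ[R] U) where
  toFun x :=
    { toFun := fun φ ↦ φ x
      map_add' := fun _ _ ↦ rfl
      map_smul' := fun _ _ ↦ rfl }
  map_add' x y := by ext φ; exact map_add φ x y
  map_smul' s x := by ext φ; exact map_smul φ s x

variable (R) in
-- A functional on (S^n)* = U^n is a tuple of `R`-endomorphisms of `U`, each the action of a unique
-- scalar in `S`.
lemma bijective_evalBidual_free
    (h : Function.Bijective (Module.toModuleEnd R U : S →+* Module.End R U)) (n : ℕ) :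
    Function.Bijective (evalBidual R S U (Fin n → S)) := by
  let c (i : Fin n) : U →ₗ[R] ((Fin n → S) →ₗ[S] U) :=
    { toFun := fun u ↦ LinearMap.toSpanSingleton S U u ∘ₗ LinearMap.proj i
      map_add' := fun u v ↦ by ext; simp
      map_smul' := fun a u ↦ LinearMap.ext fun x ↦ smul_comm (x i) a u }
  refine ⟨(injective_iff_map_eq_zero _).2 fun x hx ↦ funext fun i ↦ h.1 ?_, fun φ ↦ ?_⟩
  · ext u
    simpa [c, evalBidual] using LinearMap.congr_fun hx (c i u)
  · choose s hs using fun i ↦ h.2 (φ ∘ₗ c i)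
    refine ⟨s, LinearMap.ext fun f ↦ ?_⟩
    have hf : f = ∑ i, c i (f (Pi.single i 1)) := by
      refine (Pi.basisFun S (Fin n)).ext fun i ↦ ?_
      simp [c, Pi.single_apply]
    have hs' (i : Fin n) (u : U) : φ (c i u) = s i • u := (LinearMap.congr_fun (hs i) u).symm
    change f s = φ f
    conv_rhs => rw [hf, map_sum]
    simp only [hs']
    conv_lhs => rw [← Finset.univ_sum_single s, map_sum]
    refine Finset.sum_congr rfl fun i _ ↦ ?_
    rw [← map_smul, ← Pi.single_smul, smul_eq_mul, mul_one]

end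

end BimoduleExt

/-! ### Free resolutions and their transposes -/

namespace BimoduleExt

open Ext

/-- A resolution by finite free modules, cut into short exact sequences
`0 → K (n + 1) → S ^ (r n) → K n → 0`. -/
structure FreeRes (S : Type u) [Ring S] where
  /-- the syzygies -/
  K : ℕ → ModuleCat.{u} S
  /-- the ranks of the free modules -/
  r : ℕ → ℕ
  /-- the covers -/
  p (n : ℕ) : (Fin (r n) → S) →ₗ[S] K n
  /-- the inclusions -/
  i (n : ℕ) : K (n + 1) →ₗ[S] (Fin (r n) → S)
  surjective (n : ℕ) : Function.Surjective (p n)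
  injective (n : ℕ) : Function.Injective (i n)
  exact (n : ℕ) : Function.Exact (i n) (p n)

lemma FreeRes.exists_of_finite {S : Type u} [Ring S] [IsNoetherianRing S] (N : ModuleCat.{u} S)
    (hN : Module.Finite S N) : ∃ ρ : FreeRes S, ρ.K 0 = N := by
  choose r p hp using fun M : {M : ModuleCat.{u} S // Module.Finite S M} ↦
    have := M.2
    Module.Finite.exists_fin' S M.1
  let K : ℕ → {M : ModuleCat.{u} S // Module.Finite S M} := fun n ↦
    n.rec ⟨N, hN⟩ fun _ M ↦ ⟨ModuleCat.of S (LinearMap.ker (p M)),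
      inferInstanceAs (Module.Finite S (LinearMap.ker (p M)))⟩
  exact ⟨{  K := fun n ↦ (K n).1
            r := fun n ↦ r (K n)
            p := fun n ↦ p (K n)
            i := fun n ↦ (LinearMap.ker (p (K n))).subtype
            surjective := fun n ↦ hp (K n)
            injective := fun n ↦ Submodule.injective_subtype _
            exact := fun n ↦ LinearMap.exact_subtype_ker_map _ }, rfl⟩

namespace FreeRes

variable {R S U : Type u} [Ring R] [Ring S] [AddCommGroup U] [Module R U] [Module S U]
  [SMulCommClass R S U] [SMulCommClass S R U] (ρ : FreeRes S)

instance (n : ℕ) : Module.Finite S (ρ.K n) := Module.Finite.of_surjective _ (ρ.surjective n)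

lemma shortExact (n : ℕ) : (ModuleCat.shortComplexOfCompEqZero (ρ.i n) (ρ.p n)
    (ρ.exact n).linearMap_comp_eq_zero).ShortExact :=
  shortExact_ofHom (ρ.injective n) (ρ.exact n) (ρ.surjective n)

variable (R U) in
lemma nonempty_extMod_iso (n m : ℕ) :
    Nonempty (extMod S R U (ρ.K n) (m + 1) ≅ extMod S R U (ρ.K 0) (m + 1 + n)) := by
  induction n generalizing m with
  | zero => exact ⟨Iso.refl _⟩
  | succ n ih =>
    obtain ⟨e⟩ := BimoduleExt.nonempty_extMod_iso R (ρ.shortExact n) (U := U) (n := m + 1)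
      (m := m + 1 + 1) (by lia) (subsingleton_ext_free _ _ (by lia))
      (subsingleton_ext_free _ _ (by lia))
    obtain ⟨e'⟩ := ih (m + 1)
    rw [show m + 1 + (n + 1) = m + 1 + 1 + n by lia]
    exact ⟨e ≪≫ e'⟩

variable (R U) in
/-- The image of the dual of the `n`-th free module in the dual of the next syzygy. -/
def J (n : ℕ) : Submodule R (ρ.K (n + 1) →ₗ[S] U) := LinearMap.range (LinearMap.lcomp R U (ρ.i n))

variable (R U) in
/-- The inclusion of `J n` in the dual of the next free module. -/
def jmap (n : ℕ) : ρ.J R U n →ₗ[R] ((Fin (ρ.r (n + 1)) → S) →ₗ[S] U) :=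
  LinearMap.lcomp R U (ρ.p (n + 1)) ∘ₗ (ρ.J R U n).subtype

variable (R U) in
/-- The transpose of the `n`-th syzygy with respect to `U`. -/
abbrev X (n : ℕ) : Type u :=
  ((Fin (ρ.r (n + 1)) → S) →ₗ[S] U) ⧸ LinearMap.range (ρ.jmap R U n)

variable (R U) in
/-- The projection of the dual of the `n`-th free module to its image `J n`. -/
def toJ (n : ℕ) : ((Fin (ρ.r n) → S) →ₗ[S] U) →ₗ[R] ρ.J R U n :=
  (LinearMap.lcomp R U (ρ.i n)).rangeRestrict

lemma injective_jmap (n : ℕ) : Function.Injective (ρ.jmap R U n) :=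
  (injective_lcomp R U (ρ.surjective (n + 1))).comp (Submodule.injective_subtype _)

lemma surjective_toJ (n : ℕ) : Function.Surjective (ρ.toJ R U n) :=
  LinearMap.surjective_rangeRestrict _

lemma exact_toJ (n : ℕ) : Function.Exact (LinearMap.lcomp R U (ρ.p n)) (ρ.toJ R U n) := fun x ↦
  Iff.trans (by rw [← Subtype.coe_inj]; rfl)
    (exact_lcomp R U (ρ.exact n) (ρ.surjective n) x)

variable (R U) in
lemma shortExact_jmap (n : ℕ) : (ModuleCat.shortComplexOfCompEqZero (ρ.jmap R U n)
    (LinearMap.range (ρ.jmap R U n)).mkQ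
    (LinearMap.exact_map_mkQ_range _).linearMap_comp_eq_zero).ShortExact :=
  shortExact_ofHom (ρ.injective_jmap n) (LinearMap.exact_map_mkQ_range _)
    (Submodule.mkQ_surjective _)

variable (R U) in
/-- The inclusion of `Ext_S^1(K n, U)`, realised as a cokernel, in the transpose. -/
def toX (n : ℕ) : ((ρ.K (n + 1) →ₗ[S] U) ⧸ ρ.J R U n) →ₗ[R] ρ.X R U n :=
  (ρ.J R U n).mapQ _ (LinearMap.lcomp R U (ρ.p (n + 1))) fun y hy ↦ ⟨⟨y, hy⟩, rfl⟩

variable (R U) in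
/-- The projection of the transpose to `J (n + 1)`. -/
def ofX (n : ℕ) : ρ.X R U n →ₗ[R] ρ.J R U (n + 1) :=
  (LinearMap.range (ρ.jmap R U n)).liftQ (ρ.toJ R U (n + 1)) (by
    rintro _ ⟨y, rfl⟩
    exact (ρ.exact_toJ (n + 1) _).2 ⟨y, rfl⟩)

lemma injective_toX (n : ℕ) : Function.Injective (ρ.toX R U n) := by
  refine (injective_iff_map_eq_zero _).2 fun x hx ↦ ?_
  obtain ⟨y, rfl⟩ := Submodule.Quotient.mk_surjective _ x
  obtain ⟨z, hz⟩ := (Submodule.Quotient.mk_eq_zero _).1 hx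
  have := injective_lcomp R U (ρ.surjective (n + 1)) hz
  exact (Submodule.Quotient.mk_eq_zero _).2 (this ▸ z.2)

lemma surjective_ofX (n : ℕ) : Function.Surjective (ρ.ofX R U n) := fun y ↦ by
  obtain ⟨x, rfl⟩ := ρ.surjective_toJ (n + 1) y
  exact ⟨Submodule.Quotient.mk x, rfl⟩

lemma exact_toX_ofX (n : ℕ) : Function.Exact (ρ.toX R U n) (ρ.ofX R U n) := fun x ↦ by
  obtain ⟨x, rfl⟩ := Submodule.Quotient.mk_surjective _ x
  refine ⟨fun hx ↦ ?_, ?_⟩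
  · obtain ⟨y, rfl⟩ := (ρ.exact_toJ (n + 1) x).1 hx
    exact ⟨Submodule.Quotient.mk y, rfl⟩
  · rintro ⟨y, hy⟩
    obtain ⟨y, rfl⟩ := Submodule.Quotient.mk_surjective _ y
    rw [← hy]
    exact (ρ.exact_toJ (n + 1) _).2 ⟨y, rfl⟩

variable (R U) in
lemma nonempty_extMod_iso_quotient (n : ℕ) :
    Nonempty (extMod S R U (ρ.K 0) (n + 1) ≅
      ModuleCat.of R ((ρ.K (n + 1) →ₗ[S] U) ⧸ ρ.J R U n)) := by
  obtain ⟨δ, hδ, hδ'⟩ := exists_connecting R U (ρ.injective n) (ρ.exact n) (ρ.surjective n)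
  obtain ⟨e⟩ := ρ.nonempty_extMod_iso R U n 0
  have hn : extMod S R U (ρ.K 0) (n + 1) = extMod S R U (ρ.K 0) (0 + 1 + n) := by
    congr 1; lia
  have hJ : LinearMap.ker δ = ρ.J R U n := LinearMap.exact_iff.1 hδ
  exact ⟨eqToIso hn ≪≫ e.symm ≪≫ (δ.quotKerEquivOfSurjective
    (hδ' (subsingleton_ext_free _ _ le_rfl))).toModuleIso.symm ≪≫
    (Submodule.quotEquivOfEq _ _ hJ).toModuleIso⟩

section

variable (hbal : Function.Bijective (Module.toModuleEnd R U : S →+* Module.End R U))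
include hbal

/-- A positive syzygy embeds in a free module, whose points are separated by maps to `U`. -/
lemma p_eq_zero_of_eval {n : ℕ} (q : Fin (ρ.r (n + 1)) → S)
    (h : ∀ ψ : (Fin (ρ.r n) → S) →ₗ[S] U, ψ (ρ.i n (ρ.p (n + 1) q)) = 0) :
    ρ.p (n + 1) q = 0 := by
  refine ρ.injective n ?_
  rw [map_zero]
  exact (bijective_evalBidual_free R hbal _).1 (by rw [map_zero]; exact LinearMap.ext h)

/-- A map J_{n+1} → U pulls back to F_{n+1}* as evaluation at some `q`. It kills K_{n+1}*, so `q`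
lies in K_{n+2}; evaluation at a lift of `q` to F_{n+2} extends the given map to F_{n+2}*. -/
lemma subsingleton_ext_one_X
    (hself : ∀ i : ℕ, 1 ≤ i → Subsingleton (Ext (ModuleCat.of R U) (ModuleCat.of R U) i))
    (n : ℕ) : Subsingleton (Ext (ModuleCat.of R (ρ.X R U (n + 1))) (ModuleCat.of R U) 1) := by
  obtain ⟨δ, hδ, hδ'⟩ := exists_connecting S U (ρ.injective_jmap (R := R) (U := U) (n + 1))
    (LinearMap.exact_map_mkQ_range _) (Submodule.mkQ_surjective _)
  refine subsingleton_of_forall_eq 0 fun x ↦ ?_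
  obtain ⟨f, rfl⟩ := hδ' (Acyclic.dual_free hself _ 1 le_rfl) x
  refine (hδ f).2 ?_
  obtain ⟨q, hq⟩ := (bijective_evalBidual_free R hbal _).2 (f ∘ₗ ρ.toJ R U (n + 1))
  have hq' (ψ : (Fin (ρ.r (n + 1)) → S) →ₗ[S] U) : ψ q = f (ρ.toJ R U (n + 1) ψ) :=
    LinearMap.congr_fun hq ψ
  have h₀ := ρ.p_eq_zero_of_eval hbal q fun ψ ↦
    (hq' (ψ ∘ₗ ρ.i n ∘ₗ ρ.p (n + 1))).trans
      ((congr_arg f ((ρ.exact_toJ (n + 1) _).2 ⟨ψ ∘ₗ ρ.i n, rfl⟩)).trans (map_zero f))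
  obtain ⟨k, rfl⟩ := (ρ.exact (n + 1) q).1 h₀
  obtain ⟨q', rfl⟩ := ρ.surjective (n + 2) k
  refine ⟨evalBidual R S U _ q', LinearMap.ext fun y ↦ ?_⟩
  obtain ⟨z, rfl⟩ := ρ.surjective_toJ (n + 1) y
  exact hq' z

/-- On F_{n+1}* the map is evaluation at some `q`; killing J_n forces `q` to map to zero in K_{n+1},
so all of K_{n+1}* is killed. -/
lemma comp_toX_eq_zero (n : ℕ) (x : ρ.X R U n →ₗ[R] U) : x ∘ₗ ρ.toX R U n = 0 := by
  obtain ⟨q, hq⟩ := (bijective_evalBidual_free R hbal _).2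
    (x ∘ₗ (LinearMap.range (ρ.jmap R U n)).mkQ)
  have hq' (ψ : (Fin (ρ.r (n + 1)) → S) →ₗ[S] U) : ψ q = x (Submodule.Quotient.mk ψ) :=
    LinearMap.congr_fun hq ψ
  have h₀ := ρ.p_eq_zero_of_eval hbal q fun ψ ↦
    have hψ : ψ ∘ₗ ρ.i n ∘ₗ ρ.p (n + 1) ∈ LinearMap.range (ρ.jmap R U n) := ⟨ρ.toJ R U n ψ, rfl⟩
    (hq' _).trans ((congr_arg x ((Submodule.Quotient.mk_eq_zero _).2 hψ)).trans (map_zero x))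
  ext y
  have := hq' (y ∘ₗ ρ.p (n + 1))
  rw [LinearMap.comp_apply, h₀, map_zero] at this
  exact this.symm

lemma injective_evalBidual (n : ℕ) : Function.Injective (evalBidual R S U (ρ.K (n + 1))) := by
  refine (injective_iff_map_eq_zero _).2 fun x hx ↦ ?_
  obtain ⟨q, rfl⟩ := ρ.surjective (n + 1) x
  exact ρ.p_eq_zero_of_eval hbal q fun ψ ↦ LinearMap.congr_fun hx (ψ ∘ₗ ρ.i n)

lemma range_evalBidual (n : ℕ) : LinearMap.range (evalBidual R S U (ρ.K n)) =
    LinearMap.range (LinearMap.lcomp S U (LinearMap.lcomp R U (ρ.p n))) := by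
  ext φ
  constructor
  · rintro ⟨x, rfl⟩
    obtain ⟨q, rfl⟩ := ρ.surjective n x
    exact ⟨evalBidual R S U _ q, rfl⟩
  · rintro ⟨ψ, rfl⟩
    obtain ⟨q, rfl⟩ := (bijective_evalBidual_free R hbal _).2 ψ
    exact ⟨ρ.p n q, rfl⟩

variable [IsNoetherianRing R] [Module.Finite R U]
  (hself : ∀ i : ℕ, 1 ≤ i → Subsingleton (Ext (ModuleCat.of R U) (ModuleCat.of R U) i))
include hself

/-- S^n is the dual of (S^n)* = U^n, which is finite and acyclic over `R`. -/
lemma subsingleton_ext_free_right (E : ModuleCat.{u} S) {m j : ℕ} (hE : GradeGE S U E m)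
    (hj : j < m) (n : ℕ) : Subsingleton (Ext E (ModuleCat.of S (Fin n → S)) j) := by
  have : Module.Finite R ((Fin n → S) →ₗ[S] U) := finite_dual S
  exact subsingleton_of_iso_right E (LinearEquiv.ofBijective _
    (bijective_evalBidual_free R hbal n)).toModuleIso.symm
    ((Acyclic.dual_free hself n).subsingleton_ext_dual E hE hj)

lemma subsingleton_ext_syzygy (E : ModuleCat.{u} S) {m j n : ℕ} (hE : GradeGE S U E m)
    (hj : j < m) (hn : j < n) : Subsingleton (Ext E (ρ.K n) j) := by
  obtain ⟨n, rfl⟩ := Nat.exists_eq_add_of_lt hn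
  induction j generalizing n with
  | zero =>
    rw [zero_add]
    exact subsingleton_covariant₁_zero (ρ.shortExact n) E
      (subsingleton_ext_free_right hbal hself E hE hj _)
  | succ j ih =>
    have := ih (by lia) n (by lia)
    rw [show j + 1 + n + 1 = (j + n + 1) + 1 by lia]
    exact subsingleton_covariant₁ (ρ.shortExact (j + n + 1)) E rfl this
      (subsingleton_ext_free_right hbal hself E hE hj _)

end

end FreeRes

end BimoduleExt

/-! ### Exchanging the two sides -/

namespace BimoduleExt

open Ext

section

variable {R S U : Type u} [Ring R] [Ring S] [AddCommGroup U] [Module R U] [Module S U]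
  [SMulCommClass R S U] [SMulCommClass S R U]

variable (R S U) in
/-- `Ext_S^j(Ext_R^q(M, U), U) = 0` for all finite `M` and all `q ≥ j + 2` with `j + 2 ≤ k`. -/
def ExtExtVanish (k : ℕ) : Prop :=
  ∀ M : ModuleCat.{u} R, Module.Finite R M → ∀ j q : ℕ, j + 2 ≤ k → j + 2 ≤ q →
    Subsingleton (Ext (extMod R S U M q) (ModuleCat.of S U) j)

variable (S) in
lemma extExtVanish_of_diagonal [IsNoetherianRing R] {k : ℕ}
    (h : ∀ M : ModuleCat.{u} R, Module.Finite R M → ∀ j, j + 2 ≤ k →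
      Subsingleton (Ext (extMod R S U M (j + 2)) (ModuleCat.of S U) j)) :
    ExtExtVanish R S U k := by
  intro M hM j q hj hq
  obtain ⟨t, rfl⟩ := Nat.exists_eq_add_of_le hq
  obtain ⟨ρ, rfl⟩ := FreeRes.exists_of_finite M hM
  obtain ⟨e⟩ := ρ.nonempty_extMod_iso S U t (j + 1)
  exact subsingleton_of_iso_left e _ (h (ρ.K t) inferInstance j hj)

namespace FreeRes

variable (ρ : FreeRes S)

/-- Induction on `j`: Ext_R^{j+2}(X_n, U) ≅ Ext_R^{j+1}(J_n, U), and J_n is X_{n-1} modulo a copy of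
Ext_S^n(K_0, U), to which `hk` applies. -/
lemma subsingleton_ext_X
    (hbal : Function.Bijective (Module.toModuleEnd R U : S →+* Module.End R U))
    (hself : ∀ i : ℕ, 1 ≤ i → Subsingleton (Ext (ModuleCat.of R U) (ModuleCat.of R U) i))
    {k : ℕ} (hk : ExtExtVanish S R U (k + 1)) {j n : ℕ} (hj : j ≤ k) (hn : j + 1 ≤ n) :
    Subsingleton (Ext (ModuleCat.of R (ρ.X R U n)) (ModuleCat.of R U) (j + 1)) := by
  obtain ⟨n, rfl⟩ := Nat.exists_eq_add_of_le' hn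
  induction j generalizing n with
  | zero => exact ρ.subsingleton_ext_one_X hbal hself n
  | succ j ih =>
    obtain ⟨e⟩ := ρ.nonempty_extMod_iso_quotient R U (n + (j + 1))
    have hQ := subsingleton_of_iso_left e _
      (hk (ρ.K 0) inferInstance j (n + (j + 1) + 1) (by lia) (by lia))
    have hJ := subsingleton_contravariant₃ (shortExact_ofHom (ρ.injective_toX (n + (j + 1)))
      (ρ.exact_toX_ofX _) (ρ.surjective_ofX _)) _ (m := j + 1) (by lia) hQ
      (ih (by lia) n (by lia))
    exact subsingleton_contravariant₃ (ρ.shortExact_jmap R U (n + (j + 1) + 1)) _ (by lia) hJ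
      (Acyclic.dual_free hself _ _ (by lia))

lemma subsingleton_ext_J [IsNoetherianRing R] [Module.Finite R U]
    (hbal : Function.Bijective (Module.toModuleEnd R U : S →+* Module.End R U))
    (hself : ∀ i : ℕ, 1 ≤ i → Subsingleton (Ext (ModuleCat.of R U) (ModuleCat.of R U) i))
    {k : ℕ} (hS : ExtExtVanish S R U (k + 1)) (hR : ExtExtVanish R S U (k + 2)) :
    Subsingleton (Ext (ModuleCat.of R (ρ.J R U (k + 2))) (ModuleCat.of R U) (k + 1)) := by
  have hfin (n : ℕ) : Module.Finite R ((Fin n → S) →ₗ[S] U) := finite_dual S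
  have hfin' : Module.Finite R (ρ.K (k + 2) →ₗ[S] U) := finite_dual S
  let E := extMod R S U (ModuleCat.of R (ρ.J R U (k + 2))) (k + 1)
  obtain ⟨e⟩ := BimoduleExt.nonempty_extMod_iso S (ρ.shortExact_jmap R U (k + 2)) (U := U)
    (n := k + 1) (m := k + 2) (by lia) (Acyclic.dual_free hself _ _ (by lia))
    (Acyclic.dual_free hself _ _ (by lia))
  have hE : GradeGE S U E (k + 1) := fun j hj ↦ subsingleton_of_iso_left e.symm _
    (hR (ModuleCat.of R (ρ.X R U (k + 2)))
      (inferInstanceAs (Module.Finite R (ρ.X R U (k + 2)))) j (k + 2) (by lia) (by lia))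
  -- Here W = K_{k+2}*, P = F_{k+2}*, I = J_{k+2}, V = F_{k+1}* and L = K_{k+2}. Up to F_{k+1} ≅
  -- F_{k+1}**, the composite L → V* is the inclusion of the syzygy.
  have hid : 𝟙 E = 0 := by
    refine hom_extMod_eq_zero E k hE (injective_lcomp R U (ρ.surjective (k + 2)))
      (ρ.exact_toJ (k + 2)) (ρ.surjective_toJ _) (Acyclic.dual_free hself _)
      (Acyclic.dual_free hself _) (LinearMap.lcomp R U (ρ.i (k + 1)))
      (evalBidual R S U (ρ.K (k + 2))) (ρ.injective_evalBidual hbal _)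
      (ρ.range_evalBidual hbal _) (fun j hj hj' ↦ subsingleton_contravariant₁
        (ρ.shortExact_jmap R U (k + 2)) _ (m := j + 1) (by lia)
        (Acyclic.dual_free hself _ _ hj) (ρ.subsingleton_ext_X hbal hself hS (by lia) (by lia)))
      (fun x hx ↦ ?_) _
    let ε := LinearEquiv.ofBijective _ (bijective_evalBidual_free R hbal (ρ.r (k + 1)))
    have hε : ModuleCat.ofHom (LinearMap.lcomp S U (LinearMap.lcomp R U (ρ.i (k + 1))) ∘ₗ
        evalBidual R S U (ρ.K (k + 2))) = ModuleCat.ofHom (ρ.i (k + 1)) ≫ ε.toModuleIso.hom := rfl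
    have hx' : x.comp (mk₀ (ModuleCat.ofHom (ρ.i (k + 1)))) (add_zero _) = 0 := by
      rw [hε, ← mk₀_comp_mk₀, ← comp_assoc_of_third_deg_zero] at hx
      have := congr_arg (fun y ↦ y.comp (mk₀ ε.toModuleIso.inv) (add_zero _)) hx
      simpa only [comp_assoc_of_third_deg_zero, mk₀_comp_mk₀, Iso.hom_inv_id, comp_mk₀_id,
        zero_comp, Category.assoc, Category.comp_id] using this
    -- The kernel on Ext_S^{k+1} comes from Ext_S^k(E, K_{k+1}), which vanishes.
    obtain ⟨y, rfl⟩ := covariant_sequence_exact₁ E (ρ.shortExact (k + 1)) x hx' rfl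
    have := ρ.subsingleton_ext_syzygy hbal hself E hE (j := k) (n := k + 1) (by lia) (by lia)
    rw [Subsingleton.elim y 0, zero_comp]
  refine subsingleton_of_forall_eq 0 fun x ↦ ?_
  exact ConcreteCategory.congr_hom hid x

lemma subsingleton_ext_quotient [IsNoetherianRing R] [Module.Finite R U]
    (hbal : Function.Bijective (Module.toModuleEnd R U : S →+* Module.End R U))
    (hself : ∀ i : ℕ, 1 ≤ i → Subsingleton (Ext (ModuleCat.of R U) (ModuleCat.of R U) i))
    {k : ℕ} (hS : ExtExtVanish S R U (k + 1)) (hR : ExtExtVanish R S U (k + 2)) :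
    Subsingleton (Ext (ModuleCat.of R ((ρ.K (k + 2) →ₗ[S] U) ⧸ ρ.J R U (k + 1)))
      (ModuleCat.of R U) k) := by
  have hJ := ρ.subsingleton_ext_J hbal hself hS hR
  have hT := shortExact_ofHom (ρ.injective_toX (R := R) (U := U) (k + 1))
      (ρ.exact_toX_ofX _) (ρ.surjective_ofX _)
  cases k with
  | zero =>
    -- Hom(X_1, U) need not vanish, but its restriction to the submodule does.
    refine subsingleton_of_forall_eq 0 fun x ↦ ?_
    obtain ⟨y, rfl⟩ := contravariant_sequence_exact₁ hT _ x (add_zero 1) (Subsingleton.elim _ _)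
    obtain ⟨y, rfl⟩ := (mk₀_bijective _ _).2 y
    rw [mk₀_comp_mk₀, mk₀_eq_zero_iff]
    exact congr_arg ModuleCat.ofHom (ρ.comp_toX_eq_zero hbal 1 y.hom)
  | succ k =>
    exact subsingleton_contravariant₁ hT _ (by lia)
      (ρ.subsingleton_ext_X hbal hself hS (by lia) (by lia)) hJ

end FreeRes

lemma ExtExtVanish.swap [IsNoetherianRing R] [IsNoetherianRing S] [Module.Finite R U]
    (hbal : Function.Bijective (Module.toModuleEnd R U : S →+* Module.End R U))
    (hself : ∀ i : ℕ, 1 ≤ i → Subsingleton (Ext (ModuleCat.of R U) (ModuleCat.of R U) i))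
    {k : ℕ} (hR : ExtExtVanish R S U k) : ExtExtVanish S R U k := by
  induction k with
  | zero => exact fun _ _ _ _ h ↦ by lia
  | succ k ih =>
    have hS := ih fun M hM j q hj ↦ hR M hM j q (by lia)
    refine extExtVanish_of_diagonal R fun N hN j hj ↦ ?_
    by_cases hjk : j + 2 ≤ k
    · exact hS N hN j _ hjk le_rfl
    · obtain rfl : k = j + 1 := by lia
      obtain ⟨ρ, rfl⟩ := FreeRes.exists_of_finite N hN
      obtain ⟨e⟩ := ρ.nonempty_extMod_iso_quotient R U (j + 1)
      exact subsingleton_of_iso_left e.symm _ (ρ.subsingleton_ext_quotient hbal hself hS hR)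

end

end BimoduleExt

theorem lemma3p3 (Λ Γ U : Type u) [Ring Λ] [Ring Γ]
    [IsNoetherianRing Λ] [IsNoetherianRing Λᵐᵒᵖ] [IsNoetherianRing Γ] [IsNoetherianRing Γᵐᵒᵖ]
    [AddCommGroup U] [Module Λ U] [Module Γᵐᵒᵖ U]
    [SMulCommClass Λ Γᵐᵒᵖ U] [SMulCommClass Γᵐᵒᵖ Λ U]
    [Module.Finite Λ U] [Module.Finite Γᵐᵒᵖ U]
    (hbal : BimoduleExt.FaithfullyBalanced Λ Γᵐᵒᵖ U)
    (hself : BimoduleExt.SelfOrthogonal Λ Γᵐᵒᵖ U)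
    (k : ℕ) (hk : 0 < k) :
    List.TFAE [
      ∀ M : ModuleCat.{u} Λ, Module.Finite Λ M → ∀ i : ℕ, 1 ≤ i → i ≤ k - 1 →
        BimoduleExt.GradeGE Γᵐᵒᵖ U (BimoduleExt.extMod Λ Γᵐᵒᵖ U M (i + 1)) i,
      ∀ M : ModuleCat.{u} Λ, Module.Finite Λ M → ∀ i : ℕ, 1 ≤ i → i ≤ k - 1 →
        Subsingleton
          (Abelian.Ext (BimoduleExt.extMod Λ Γᵐᵒᵖ U M (i + 1)) (ModuleCat.of Γᵐᵒᵖ U) (i - 1)),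
      ∀ N : ModuleCat.{u} Γᵐᵒᵖ, Module.Finite Γᵐᵒᵖ N → ∀ i : ℕ, 1 ≤ i → i ≤ k - 1 →
        BimoduleExt.GradeGE Λ U (BimoduleExt.extMod Γᵐᵒᵖ Λ U N (i + 1)) i,
      ∀ N : ModuleCat.{u} Γᵐᵒᵖ, Module.Finite Γᵐᵒᵖ N → ∀ i : ℕ, 1 ≤ i → i ≤ k - 1 →
        Subsingleton
          (Abelian.Ext (BimoduleExt.extMod Γᵐᵒᵖ Λ U N (i + 1)) (ModuleCat.of Λ U) (i - 1))] := by
  have key (R S : Type u) [Ring R] [Ring S] [IsNoetherianRing R] [Module R U] [Module S U]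
      [SMulCommClass R S U] [SMulCommClass S R U] :
      ((∀ M : ModuleCat.{u} R, Module.Finite R M → ∀ i : ℕ, 1 ≤ i → i ≤ k - 1 →
        BimoduleExt.GradeGE S U (BimoduleExt.extMod R S U M (i + 1)) i) ↔
          BimoduleExt.ExtExtVanish R S U k) ∧
      ((∀ M : ModuleCat.{u} R, Module.Finite R M → ∀ i : ℕ, 1 ≤ i → i ≤ k - 1 →
        Subsingleton (Abelian.Ext (BimoduleExt.extMod R S U M (i + 1)) (ModuleCat.of S U)
          (i - 1))) ↔ BimoduleExt.ExtExtVanish R S U k) := by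
    refine ⟨⟨fun h ↦ ?_, fun h M hM i hi hik j hj ↦ h M hM j _ (by lia) (by lia)⟩,
      ⟨fun h ↦ ?_, fun h M hM i hi hik ↦ h M hM _ _ (by lia) (by lia)⟩⟩
    · exact BimoduleExt.extExtVanish_of_diagonal S fun M hM j hj ↦
        h M hM (j + 1) (by lia) (by lia) j (by lia)
    · exact BimoduleExt.extExtVanish_of_diagonal S fun M hM j hj ↦
        h M hM (j + 1) (by lia) (by lia)
  obtain ⟨h₁, h₂⟩ := key Λ Γᵐᵒᵖ
  obtain ⟨h₃, h₄⟩ := key Γᵐᵒᵖ Λ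
  -- Each direction needs balance and selforthogonality only for `U` over the ring of the outer Ext
  -- in its conclusion.
  have h : BimoduleExt.ExtExtVanish Λ Γᵐᵒᵖ U k ↔ BimoduleExt.ExtExtVanish Γᵐᵒᵖ Λ U k :=
    ⟨.swap hbal.2 hself.1, .swap hbal.1 hself.2⟩
  tfae_have 1 ↔ 2 := h₁.trans h₂.symm
  tfae_have 1 ↔ 3 := h₁.trans (h.trans h₃.symm)
  tfae_have 3 ↔ 4 := h₃.trans h₄.symm
  tfae_finish
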